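/- All Hilbert spaces are finite dimensional and nonzero, with $d_A=\dim\mathcal H_A$; $\mathcal B(A)$ denotes the operators and $\mathfrak S(A)$ the states (positive operators of trace one) on $\mathcal H_A$, and $\mathcal C(A,B)$ denotes the set of quantum channels, i.e. completely positive trace preserving linear maps $\mathcal B(A)\to\mathcal B(B)$. Let $\|X\|_1=\mathrm{Tr}\,|X|$ be the trace norm and, for a hermitian linear map $\Phi:\mathcal B(A_0)\to\mathcal B(A_1)$, let $$\|\Phi\|_\diamond=\max_{\rho\in\mathfrak S(A_0A_0)}\|(\Phi\otimes id)(\rho)\|_1$$ be its diamond norm. For $\Phi_1\in\mathcal C(A_0,A_1)$ and $\Phi_2\in\mathcal C(A_0',A_1)$ put $$\delta_{\mathrm{pre}}(\Phi_1\|\Phi_2)=\inf_{\Lambda\in\mathcal C(A_0',A_0)}\|\Phi_1\circ\Lambda-\Phi_2\|_\diamond,\qquad \Delta_{\mathrm{pre}}(\Phi_1,\Phi_2)=\max\{\delta_{\mathrm{pre}}(\Phi_1\|\Phi_2),\delta_{\mathrm{pre}}(\Phi_2\|\Phi_1)\}.$$ The range of a channel $\Phi\in\mathcal C(A,B)$ is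 $\mathcal R(\Phi)=\Phi(\mathfrak S(A))$. **Corollary.** Let $\Phi_1\in\mathcal C(A_0,A_1)$, $\Phi_2\in\mathcal C(A_0',A_1)$ and let $R$ be a system with $d_R=\max\{d_{A_0},d_{A_0'}\}$. Then $$\Delta_{\mathrm{pre}}(\Phi_1,\Phi_2)=m_H\big(\mathcal R(\Phi_1\otimes id_R),\mathcal R(\Phi_2\otimes id_R)\big),$$ where $$m_H(S,T)=\max\Big\{\sup_{s\in S}\inf_{t\in T}m(s,t),\ \sup_{t\in T}\inf_{s\in S}m(s,t)\Big\}$$ is the Hausdorff distance with respect to the metric $m$ on $\mathfrak S(A_1R)$ given by $$m(\xi,\sigma)=\|\xi-\sigma\|_1+2p(\xi_R,\sigma_R).$$ Here $\xi_R=\mathrm{Tr}_{A_1}\xi$ is the restriction of $\xi$ to $R$, $p(\sigma_1,\sigma_2)=\sqrt{1-F(\sigma_1,\sigma_2)^2}$ is the purified distance and $F(\sigma_1,\sigma_2)=\|\sigma_1^{1/2}\sigma_2^{1/2}\|_1$ is the fidelity of states on $R$. -/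

import Mathlib

/-! Finite dimensional quantum systems. A system is given by a finite type `a` labelling the standard
basis of its Hilbert space, the operators on it are the complex `a × a` matrices, and the composite
of the systems `a` and `r` is labelled by the product type `a × r`. -/

namespace PreDist

open scoped ComplexOrder MatrixOrder Kronecker

noncomputable section

variable {a b c r : Type*} [Fintype a] [DecidableEq a] [Fintype b] [DecidableEq b]
  [Fintype c] [DecidableEq c] [Fintype r] [DecidableEq r]

/-- The set of states (density matrices). -/
def states (a : Type*) [Fintype a] : Set (Matrix a a ℂ) :=
  {ρ | ρ.PosSemidef ∧ ρ.trace = 1}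

/-- The map `Φ ⊗ id_r`: it applies `Φ` to each of the blocks `(X (·, k) (·, l))`. -/
def tensorId (r : Type*) (Φ : Matrix a a ℂ →ₗ[ℂ] Matrix b b ℂ) :
    Matrix (a × r) (a × r) ℂ →ₗ[ℂ] Matrix (b × r) (b × r) ℂ where
  toFun X := Matrix.of fun p q => Φ (Matrix.of fun i j => X (i, p.2) (j, q.2)) p.1 q.1
  map_add' X Y := by
    ext p q
    exact congrFun (congrFun (Φ.map_add (Matrix.of fun i j => X (i, p.2) (j, q.2))
      (Matrix.of fun i j => Y (i, p.2) (j, q.2))) p.1) q.1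
  map_smul' z X := by
    ext p q
    exact congrFun (congrFun (Φ.map_smul z (Matrix.of fun i j => X (i, p.2) (j, q.2))) p.1) q.1

/-- `Φ ⊗ id_r` acts on product operators as it should. -/
theorem tensorId_kronecker {a b r : Type*} (Φ : Matrix a a ℂ →ₗ[ℂ] Matrix b b ℂ) (A : Matrix a a ℂ)
    (B : Matrix r r ℂ) : tensorId r Φ (A ⊗ₖ B) = Φ A ⊗ₖ B := by
  ext p q
  have h : (Matrix.of fun i j => (A ⊗ₖ B) (i, p.2) (j, q.2)) = B p.2 q.2 • A := by
    ext i j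
    simp [Matrix.kroneckerMap_apply, mul_comm]
  change Φ (Matrix.of fun i j => (A ⊗ₖ B) (i, p.2) (j, q.2)) p.1 q.1 = _
  rw [h, map_smul]
  simp [Matrix.kroneckerMap_apply, mul_comm]

/-- Complete positivity: `Φ ⊗ id` is positive for every finite dimensional ancilla. -/
def IsCompletelyPositive (Φ : Matrix a a ℂ →ₗ[ℂ] Matrix b b ℂ) : Prop :=
  ∀ (n : ℕ) (X : Matrix (a × Fin n) (a × Fin n) ℂ),
    X.PosSemidef → (tensorId (Fin n) Φ X).PosSemidef

/-- The set of quantum channels: completely positive trace preserving linear maps. -/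
def channels (a b : Type*) [Fintype a] [Fintype b] : Set (Matrix a a ℂ →ₗ[ℂ] Matrix b b ℂ) :=
  {Φ | IsCompletelyPositive Φ ∧ ∀ X, (Φ X).trace = X.trace}

/-- The trace norm `‖X‖₁ = Tr |X|`, with `|X| = (X* X)^{1/2}`. -/
def traceNorm (X : Matrix a a ℂ) : ℝ :=
  (CFC.sqrt (X.conjTranspose * X)).trace.re

/-- The diamond norm of a (hermitian) linear map `Φ`: the supremum of `‖(Φ ⊗ id)(ρ)‖₁` over the states
`ρ` of the composite of two copies of the input system. -/
def diamondNorm (Φ : Matrix a a ℂ →ₗ[ℂ] Matrix b b ℂ) : ℝ :=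
  ⨆ ρ : states (a × a), traceNorm (tensorId a Φ ρ)

/-- One-way conversion distance by preprocessings, `δ_pre(Φ₁‖Φ₂)`. -/
def deltaPre (Φ₁ : Matrix a a ℂ →ₗ[ℂ] Matrix c c ℂ) (Φ₂ : Matrix b b ℂ →ₗ[ℂ] Matrix c c ℂ) : ℝ :=
  ⨅ Λ : channels b a, diamondNorm (Φ₁ ∘ₗ (Λ : Matrix b b ℂ →ₗ[ℂ] Matrix a a ℂ) - Φ₂)

/-- The preprocessing pseudodistance `Δ_pre(Φ₁, Φ₂)`. -/
def DeltaPre (Φ₁ : Matrix a a ℂ →ₗ[ℂ] Matrix c c ℂ) (Φ₂ : Matrix b b ℂ →ₗ[ℂ] Matrix c c ℂ) : ℝ :=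
  max (deltaPre Φ₁ Φ₂) (deltaPre Φ₂ Φ₁)

/-- The range of a channel: the image of the set of all states. -/
def channelRange (Φ : Matrix a a ℂ →ₗ[ℂ] Matrix b b ℂ) : Set (Matrix b b ℂ) :=
  Φ '' states a

/-- The restriction `ξ_r = Tr_a ξ` of `ξ` to the second system. -/
def restrictRight (ξ : Matrix (a × r) (a × r) ℂ) : Matrix r r ℂ :=
  Matrix.of fun k l => ∑ i, ξ (i, k) (i, l)

/-- The fidelity `F(ρ, σ) = ‖ρ^{1/2} σ^{1/2}‖₁`. -/
def fidelity (ρ σ : Matrix a a ℂ) : ℝ :=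
  traceNorm (CFC.sqrt ρ * CFC.sqrt σ)

/-- The purified distance. -/
def purifiedDist (ρ σ : Matrix a a ℂ) : ℝ :=
  Real.sqrt (1 - fidelity ρ σ ^ 2)

/-- The metric `m(ξ, σ) = ‖ξ - σ‖₁ + 2 p(ξ_r, σ_r)` on the states of the composite of `a` and `r`. -/
def stateDist (ξ σ : Matrix (a × r) (a × r) ℂ) : ℝ :=
  traceNorm (ξ - σ) + 2 * purifiedDist (restrictRight ξ) (restrictRight σ)

/-- The Hausdorff distance of two sets with respect to a distance function `m`. -/
def hausdorffDist {X : Type*} (m : X → X → ℝ) (S T : Set X) : ℝ :=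
  max (⨆ s : S, ⨅ t : T, m s t) (⨆ t : T, ⨅ s : S, m s t)

end

end PreDist

namespace PreDist

open scoped ComplexOrder MatrixOrder Kronecker
open Matrix

set_option linter.unusedSectionVars false

section TraceNorm

variable {m n k : Type*} [Fintype m] [DecidableEq m] [Fintype n] [DecidableEq n] [Fintype k]
  [DecidableEq k]

theorem sqrt_posSemidef (A : Matrix n n ℂ) : (CFC.sqrt A).PosSemidef :=
  nonneg_iff_posSemidef.1 (CFC.sqrt_nonneg A)

theorem sqrt_mul_sqrt {A : Matrix n n ℂ} (hA : A.PosSemidef) : CFC.sqrt A * CFC.sqrt A = A :=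
  CFC.sqrt_mul_sqrt_self A (nonneg_iff_posSemidef.2 hA)

theorem sqrt_eq_of_mul_self {A B : Matrix n n ℂ} (hB : B.PosSemidef) (h : B * B = A) :
    CFC.sqrt A = B :=
  CFC.sqrt_unique h (nonneg_iff_posSemidef.2 hB)

theorem exists_eq_mul_conjTranspose {A : Matrix n n ℂ} (hA : A.PosSemidef) :
    ∃ G : Matrix n n ℂ, A = G * Gᴴ :=
  ⟨CFC.sqrt A, by rw [(sqrt_posSemidef A).isHermitian.eq, sqrt_mul_sqrt hA]⟩

theorem re_trace_mul_nonneg {A B : Matrix n n ℂ} (hA : A.PosSemidef) (hB : B.PosSemidef) :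
    0 ≤ (A * B).trace.re := by
  obtain ⟨G, rfl⟩ := exists_eq_mul_conjTranspose hB
  rw [← Matrix.mul_assoc, trace_mul_comm, ← Matrix.mul_assoc]
  exact (Complex.le_def.1 (hA.conjTranspose_mul_mul_same G).trace_nonneg).1

theorem re_trace_nonneg {A : Matrix n n ℂ} (hA : A.PosSemidef) : 0 ≤ A.trace.re :=
  (Complex.le_def.1 hA.trace_nonneg).1

theorem traceNorm_of_posSemidef {A : Matrix n n ℂ} (hA : A.PosSemidef) :
    traceNorm A = A.trace.re := by
  rw [traceNorm, sqrt_eq_of_mul_self hA (by rw [hA.isHermitian.eq])]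

theorem traceNorm_nonneg (A : Matrix n n ℂ) : 0 ≤ traceNorm A :=
  re_trace_nonneg (sqrt_posSemidef _)

theorem traceNorm_neg (A : Matrix n n ℂ) : traceNorm (-A) = traceNorm A := by
  simp [traceNorm]

/-- The Jordan decomposition of a hermitian matrix, together with its sign. -/
theorem exists_jordan {X : Matrix n n ℂ} (hX : X.IsHermitian) :
    ∃ P Q S : Matrix n n ℂ, P.PosSemidef ∧ Q.PosSemidef ∧ X = P - Q ∧ S.IsHermitian ∧ S * S = 1 ∧
      S * X = P + Q ∧ traceNorm X = (P + Q).trace.re := by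
  have hX' : IsSelfAdjoint X := hX
  have hc : ∀ f : ℝ → ℝ, ContinuousOn f (spectrum ℝ X) := fun f =>
    (Matrix.finite_real_spectrum (A := X)).continuousOn f
  have hid : cfc (fun x : ℝ => x) X = X := cfc_id' ℝ X
  have hP : (cfc (fun x : ℝ => max x 0) X).PosSemidef :=
    nonneg_iff_posSemidef.1 (cfc_nonneg fun x _ => le_max_right _ _)
  have hQ : (cfc (fun x : ℝ => max (-x) 0) X).PosSemidef :=
    nonneg_iff_posSemidef.1 (cfc_nonneg fun x _ => le_max_right _ _)
  have hsum : cfc (fun x : ℝ => max x 0) X + cfc (fun x : ℝ => max (-x) 0) X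
      = cfc (fun x : ℝ => |x|) X := by
    rw [← cfc_add X _ _ (hc _) (hc _)]
    refine cfc_congr fun x _ => ?_
    rcases le_total x 0 with h | h <;> simp [h, abs_of_nonneg, abs_of_nonpos]
  have habs : (cfc (fun x : ℝ => |x|) X).PosSemidef :=
    nonneg_iff_posSemidef.1 (cfc_nonneg fun x _ => abs_nonneg _)
  refine ⟨_, _, cfc (fun x : ℝ => if x < 0 then -1 else 1) X, hP, hQ, ?_,
    cfc_predicate (p := IsSelfAdjoint) (fun x : ℝ => if x < 0 then -1 else 1) X, ?_, ?_, ?_⟩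
  · rw [← cfc_sub (a := X) _ _ (hc _) (hc _)]
    conv_lhs => rw [← hid]
    refine cfc_congr fun x _ => ?_
    rcases le_total x 0 with h | h <;> simp [h]
  · rw [← cfc_mul _ _ X (hc _) (hc _), ← cfc_one ℝ X]
    refine cfc_congr fun x _ => ?_
    by_cases h : x < 0 <;> simp [h]
  · rw [hsum]
    conv_lhs => rw [← hid]
    rw [hid]
    nth_rewrite 2 [← hid]
    rw [← cfc_mul _ _ X (hc _) (hc _)]
    refine cfc_congr fun x _ => ?_
    by_cases h : x < 0
    · simp [h, abs_of_neg h]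
    · simp [h, abs_of_nonneg (not_lt.1 h)]
  · rw [hsum, traceNorm, sqrt_eq_of_mul_self habs]
    rw [hX.eq, ← cfc_mul _ _ X (hc _) (hc _)]
    conv_rhs => rw [← hid, ← cfc_mul _ _ X (hc _) (hc _)]
    refine cfc_congr fun x _ => ?_
    simp

theorem posSemidef_one_add_of_mul_self {S : Matrix n n ℂ} (hS : S.IsHermitian) (h : S * S = 1) :
    (1 + S).PosSemidef := by
  have h1 : (1 + S) = (2⁻¹ : ℝ) • ((1 + S) * (1 + S)ᴴ) := by
    rw [conjTranspose_add, conjTranspose_one, hS.eq, mul_add, add_mul, add_mul, h]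
    simp only [one_mul, mul_one]
    module
  rw [h1]
  exact (posSemidef_self_mul_conjTranspose _).smul (by norm_num)

theorem posSemidef_one_sub_of_mul_self {S : Matrix n n ℂ} (hS : S.IsHermitian) (h : S * S = 1) :
    (1 - S).PosSemidef := by
  rw [sub_eq_add_neg]
  exact posSemidef_one_add_of_mul_self hS.neg (by simp [h])

/-- The trace norm of a hermitian matrix is attained at a reflection. -/
theorem exists_reflection {X : Matrix n n ℂ} (hX : X.IsHermitian) :
    ∃ S : Matrix n n ℂ, S.IsHermitian ∧ S * S = 1 ∧ (S * X).trace.re = traceNorm X := by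
  obtain ⟨P, Q, S, -, -, -, hS, hSS, hSX, hn⟩ := exists_jordan hX
  exact ⟨S, hS, hSS, by rw [hn, hSX]⟩

theorem re_trace_mul_le_of_posSemidef {P T : Matrix n n ℂ} (hP : P.PosSemidef)
    (h : (1 - T).PosSemidef) : (T * P).trace.re ≤ P.trace.re := by
  have := re_trace_mul_nonneg h hP
  rw [sub_mul, one_mul, trace_sub, Complex.sub_re] at this
  linarith

theorem re_trace_mul_sub_le {P Q T : Matrix n n ℂ} (hP : P.PosSemidef) (hQ : Q.PosSemidef)
    (h₁ : (1 - T).PosSemidef) (h₂ : (1 + T).PosSemidef) :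
    (T * (P - Q)).trace.re ≤ P.trace.re + Q.trace.re := by
  have hp := re_trace_mul_le_of_posSemidef hP h₁
  have hq := re_trace_mul_le_of_posSemidef (T := -T) hQ (by rwa [sub_neg_eq_add])
  rw [neg_mul, trace_neg, Complex.neg_re] at hq
  rw [mul_sub, trace_sub, Complex.sub_re]
  linarith

theorem re_trace_mul_le_traceNorm {X T : Matrix n n ℂ} (hX : X.IsHermitian)
    (h₁ : (1 - T).PosSemidef) (h₂ : (1 + T).PosSemidef) : (T * X).trace.re ≤ traceNorm X := by
  obtain ⟨P, Q, S, hP, hQ, rfl, -, -, -, hn⟩ := exists_jordan hX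
  rw [hn, trace_add, Complex.add_re]
  exact re_trace_mul_sub_le hP hQ h₁ h₂

theorem traceNorm_add_le {X Y : Matrix n n ℂ} (hX : X.IsHermitian) (hY : Y.IsHermitian) :
    traceNorm (X + Y) ≤ traceNorm X + traceNorm Y := by
  obtain ⟨S, hS, hSS, hn⟩ := exists_reflection (hX.add hY)
  have h₁ := posSemidef_one_sub_of_mul_self hS hSS
  have h₂ := posSemidef_one_add_of_mul_self hS hSS
  rw [← hn, mul_add, trace_add, Complex.add_re]
  exact add_le_add (re_trace_mul_le_traceNorm hX h₁ h₂) (re_trace_mul_le_traceNorm hY h₁ h₂)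

theorem traceNorm_sub_le_of_posSemidef {P Q : Matrix n n ℂ} (hP : P.PosSemidef)
    (hQ : Q.PosSemidef) : traceNorm (P - Q) ≤ P.trace.re + Q.trace.re := by
  obtain ⟨S, hS, hSS, hn⟩ := exists_reflection (hP.isHermitian.sub hQ.isHermitian)
  rw [← hn]
  exact re_trace_mul_sub_le hP hQ (posSemidef_one_sub_of_mul_self hS hSS)
    (posSemidef_one_add_of_mul_self hS hSS)

/-- Two factors of the same positive matrix differ by a unitary. -/
theorem exists_unitary_of_mul_conjTranspose_eq {M N : Matrix m n ℂ} (h : M * Mᴴ = N * Nᴴ) :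
    ∃ U : Matrix n n ℂ, U * Uᴴ = 1 ∧ N = M * U := by
  let f := toEuclideanLin Mᴴ
  let g := toEuclideanLin Nᴴ
  have key : ∀ (K : Matrix m n ℂ) (x : EuclideanSpace ℂ m),
      ‖toEuclideanLin Kᴴ x‖ ^ 2 = (inner ℂ x (toEuclideanLin (K * Kᴴ) x)).re := by
    intro K x
    have : toEuclideanLin (K * Kᴴ) x = toEuclideanLin K (toEuclideanLin Kᴴ x) := by
      simp [toLpLin_apply, mulVec_mulVec]
    rw [this, ← LinearMap.adjoint_inner_left, ← toEuclideanLin_conjTranspose_eq_adjoint,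
      inner_self_eq_norm_sq_to_K]
    norm_cast
  have hfg : ∀ x, ‖f x‖ = ‖g x‖ := fun x => by
    have : ‖f x‖ ^ 2 = ‖g x‖ ^ 2 := by rw [key M x, key N x, h]
    exact (sq_eq_sq₀ (norm_nonneg _) (norm_nonneg _)).1 this
  obtain ⟨s, hs⟩ := f.rangeRestrict.exists_rightInverse_of_surjective f.range_rangeRestrict
  have hs' : ∀ y, f (s y) = y := fun y => congrArg Subtype.val (LinearMap.congr_fun hs y)
  let V : LinearMap.range f →ₗᵢ[ℂ] EuclideanSpace ℂ n :=
    ⟨g ∘ₗ s, fun y => by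
      change ‖g (s y)‖ = ‖y‖
      rw [← hfg, hs']
      rfl⟩
  have hV : ∀ x, V.extend (f x) = g x := fun x => by
    have h1 := V.extend_apply ⟨f x, LinearMap.mem_range_self f x⟩
    rw [h1]
    change g (s _) = g x
    rw [← sub_eq_zero, ← map_sub, ← norm_eq_zero, ← hfg, map_sub, hs', norm_eq_zero, sub_eq_zero]
  set W : Matrix n n ℂ := toEuclideanLin.symm V.extend.toLinearMap with hW
  have hW' : toEuclideanLin W = V.extend.toLinearMap := by simp [hW]
  have h1 : Wᴴ * W = 1 := by
    apply toEuclideanLin.injective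
    ext1 x
    refine ext_inner_left ℂ fun y => ?_
    have : toEuclideanLin (Wᴴ * W) x = toEuclideanLin Wᴴ (toEuclideanLin W x) := by
      simp [toLpLin_apply, mulVec_mulVec]
    rw [this, toEuclideanLin_conjTranspose_eq_adjoint, LinearMap.adjoint_inner_right, hW']
    simp
  have h2 : Nᴴ = W * Mᴴ := by
    apply toEuclideanLin.injective
    ext1 x
    have : toEuclideanLin (W * Mᴴ) x = toEuclideanLin W (toEuclideanLin Mᴴ x) := by
      simp [toLpLin_apply, mulVec_mulVec]
    rw [this, hW']
    exact (hV x).symm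
  refine ⟨Wᴴ, by rwa [conjTranspose_conjTranspose], ?_⟩
  rw [← conjTranspose_conjTranspose N, h2, conjTranspose_mul, conjTranspose_conjTranspose]

theorem exists_coisometry (h : Fintype.card m ≤ Fintype.card n) :
    ∃ W : Matrix m n ℂ, W * Wᴴ = 1 := by
  obtain ⟨e⟩ := Function.Embedding.nonempty_of_card_le h
  refine ⟨(1 : Matrix n n ℂ).submatrix e id, ?_⟩
  rw [conjTranspose_submatrix, ← submatrix_mul _ _ _ _ _ Function.bijective_id]
  simp [submatrix_one _ e.injective]

/-- Two factors of the same positive matrix, of possibly different sizes, differ by a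
coisometry. -/
theorem exists_coisometry_of_mul_conjTranspose_eq (hc : Fintype.card n ≤ Fintype.card k)
    {M : Matrix m n ℂ} {N : Matrix m k ℂ} (h : M * Mᴴ = N * Nᴴ) :
    ∃ Z : Matrix n k ℂ, Z * Zᴴ = 1 ∧ N = M * Z := by
  obtain ⟨W, hW⟩ := exists_coisometry hc
  obtain ⟨U, hU, hN⟩ := exists_unitary_of_mul_conjTranspose_eq (M := M * W) (N := N) (by
    rw [conjTranspose_mul, Matrix.mul_assoc, ← Matrix.mul_assoc W, hW, Matrix.one_mul, h])
  refine ⟨W * U, ?_, by rw [hN, Matrix.mul_assoc]⟩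
  rw [conjTranspose_mul, Matrix.mul_assoc, ← Matrix.mul_assoc U, hU, Matrix.one_mul, hW]

/-- The polar decomposition. -/
theorem exists_polar (X : Matrix n n ℂ) :
    ∃ U : Matrix n n ℂ, U * Uᴴ = 1 ∧ X = U * CFC.sqrt (Xᴴ * X) := by
  have hP := sqrt_posSemidef (Xᴴ * X)
  have hh := sqrt_mul_sqrt (posSemidef_conjTranspose_mul_self X)
  obtain ⟨U, hU, h⟩ := exists_unitary_of_mul_conjTranspose_eq (M := CFC.sqrt (Xᴴ * X)) (N := Xᴴ)
    (by rw [hP.isHermitian.eq, hh, conjTranspose_conjTranspose])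
  refine ⟨Uᴴ, ?_, ?_⟩
  · rw [conjTranspose_conjTranspose]
    exact mul_eq_one_comm.1 hU
  · have := congrArg conjTranspose h
    rwa [conjTranspose_conjTranspose, conjTranspose_mul, hP.isHermitian.eq] at this

theorem exists_unitary_trace_mul (X : Matrix n n ℂ) :
    ∃ U : Matrix n n ℂ, U * Uᴴ = 1 ∧ (U * X).trace.re = traceNorm X := by
  obtain ⟨U, hU, h⟩ := exists_polar X
  refine ⟨Uᴴ, by rw [conjTranspose_conjTranspose]; exact mul_eq_one_comm.1 hU, ?_⟩
  rw [traceNorm]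
  conv_lhs => rw [h]
  rw [← Matrix.mul_assoc, mul_eq_one_comm.1 hU, Matrix.one_mul]

theorem traceNorm_conjTranspose (X : Matrix n n ℂ) : traceNorm Xᴴ = traceNorm X := by
  obtain ⟨U, hU, h⟩ := exists_polar X
  have hP := sqrt_posSemidef (Xᴴ * X)
  have hU' := mul_eq_one_comm.1 hU
  rw [traceNorm, traceNorm, sqrt_eq_of_mul_self (B := U * CFC.sqrt (Xᴴ * X) * Uᴴ)]
  · rw [trace_mul_comm, ← Matrix.mul_assoc, hU', Matrix.one_mul]
  · exact hP.mul_mul_conjTranspose_same U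
  · rw [conjTranspose_conjTranspose]
    have h2 : X * Xᴴ = U * CFC.sqrt (Xᴴ * X) * (U * CFC.sqrt (Xᴴ * X))ᴴ := by rw [← h]
    rw [h2, conjTranspose_mul, hP.isHermitian.eq]
    simp only [Matrix.mul_assoc]
    rw [← Matrix.mul_assoc Uᴴ U, hU', Matrix.one_mul]

theorem fidelity_comm (ρ σ : Matrix n n ℂ) : fidelity ρ σ = fidelity σ ρ := by
  rw [fidelity, fidelity, ← traceNorm_conjTranspose, conjTranspose_mul,
    (sqrt_posSemidef ρ).isHermitian.eq, (sqrt_posSemidef σ).isHermitian.eq]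

theorem purifiedDist_comm (ρ σ : Matrix n n ℂ) : purifiedDist ρ σ = purifiedDist σ ρ := by
  rw [purifiedDist, purifiedDist, fidelity_comm]

theorem purifiedDist_self {ρ : Matrix n n ℂ} (hρ : ρ ∈ states n) : purifiedDist ρ ρ = 0 := by
  rw [purifiedDist, fidelity, sqrt_mul_sqrt hρ.1, traceNorm_of_posSemidef hρ.1, hρ.2]
  simp

theorem purifiedDist_le_one (ρ σ : Matrix n n ℂ) : purifiedDist ρ σ ≤ 1 := by
  rw [purifiedDist]
  exact Real.sqrt_le_one.2 (by nlinarith [sq_nonneg (fidelity ρ σ)])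

theorem purifiedDist_nonneg (ρ σ : Matrix n n ℂ) : 0 ≤ purifiedDist ρ σ :=
  Real.sqrt_nonneg _

theorem re_trace_conjTranspose_mul_sq_le (G H : Matrix m n ℂ) :
    (Gᴴ * H).trace.re ^ 2 ≤ (Gᴴ * G).trace.re * (Hᴴ * H).trace.re := by
  have key : ∀ A B : Matrix m n ℂ, (Aᴴ * B).trace =
      inner ℂ (WithLp.toLp 2 fun p : n × m => A p.2 p.1)
        (WithLp.toLp 2 fun p : n × m => B p.2 p.1) := by
    intro A B
    simp [trace, Matrix.mul_apply, PiLp.inner_apply, Fintype.sum_prod_type, mul_comm]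
  rw [key, key, key]
  generalize WithLp.toLp 2 (fun p : n × m => G p.2 p.1) = x
  generalize WithLp.toLp 2 (fun p : n × m => H p.2 p.1) = y
  have hx : (inner ℂ x x : ℂ).re = ‖x‖ ^ 2 := inner_self_eq_norm_sq (𝕜 := ℂ) x
  have hy : (inner ℂ y y : ℂ).re = ‖y‖ ^ 2 := inner_self_eq_norm_sq (𝕜 := ℂ) y
  rw [hx, hy, ← mul_pow, ← sq_abs]
  exact pow_le_pow_left₀ (abs_nonneg _)
    ((Complex.abs_re_le_norm _).trans (norm_inner_le_norm x y)) 2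

theorem re_trace_conjTranspose (A : Matrix n n ℂ) : Aᴴ.trace.re = A.trace.re := by
  rw [trace_conjTranspose]
  exact Complex.conj_re _

theorem traceNorm_sub_le_of_purifications {G H : Matrix m n ℂ} (hG : (G * Gᴴ).trace = 1)
    (hH : (H * Hᴴ).trace = 1) :
    traceNorm (G * Gᴴ - H * Hᴴ) ≤ 2 * Real.sqrt (1 - (Gᴴ * H).trace.re ^ 2) := by
  obtain ⟨S, hS, hSS, hn⟩ := exists_reflection
    ((posSemidef_self_mul_conjTranspose G).isHermitian.sub
      (posSemidef_self_mul_conjTranspose H).isHermitian)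
  have hG' : (Gᴴ * G).trace = 1 := by rw [trace_mul_comm, hG]
  have hH' : (Hᴴ * H).trace = 1 := by rw [trace_mul_comm, hH]
  have hHG : (Hᴴ * G).trace.re = (Gᴴ * H).trace.re := by
    rw [← re_trace_conjTranspose, conjTranspose_mul, conjTranspose_conjTranspose]
  have h1 : (S * (G * Gᴴ - H * Hᴴ)).trace.re = ((G - H)ᴴ * (S * (G + H))).trace.re := by
    have e1 : (S * (G * Gᴴ)).trace = (Gᴴ * (S * G)).trace := by
      rw [← Matrix.mul_assoc, trace_mul_comm]
    have e2 : (S * (H * Hᴴ)).trace = (Hᴴ * (S * H)).trace := by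
      rw [← Matrix.mul_assoc, trace_mul_comm]
    have e3 : (Gᴴ * (S * H)).trace.re = (Hᴴ * (S * G)).trace.re := by
      rw [← re_trace_conjTranspose, conjTranspose_mul, conjTranspose_mul, conjTranspose_conjTranspose, hS.eq, Matrix.mul_assoc]
    simp only [Matrix.mul_sub, Matrix.mul_add, Matrix.sub_mul, conjTranspose_sub, trace_sub, trace_add, Complex.sub_re,
      Complex.add_re, e1, e2, e3]
    ring
  have h2 := re_trace_conjTranspose_mul_sq_le (G - H) (S * (G + H))
  have h3 : ((S * (G + H))ᴴ * (S * (G + H))).trace.re = 2 + 2 * (Gᴴ * H).trace.re := by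
    rw [conjTranspose_mul, hS.eq, Matrix.mul_assoc, ← Matrix.mul_assoc S, hSS, Matrix.one_mul]
    simp only [Matrix.mul_add, Matrix.add_mul, conjTranspose_add, trace_add, Complex.add_re, hG', hH', hHG,
      Complex.one_re]
    ring
  have h4 : ((G - H)ᴴ * (G - H)).trace.re = 2 - 2 * (Gᴴ * H).trace.re := by
    simp only [Matrix.mul_sub, Matrix.sub_mul, conjTranspose_sub, trace_sub, Complex.sub_re, hG', hH', hHG,
      Complex.one_re]
    ring
  rw [h3, h4] at h2
  rw [← hn, h1, ← Real.sqrt_sq (zero_le_two (α := ℝ)), ← Real.sqrt_mul (by norm_num)]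
  exact Real.le_sqrt_of_sq_le (by linarith)

end TraceNorm

section Choi

variable {a b c r e : Type*} [Fintype a] [DecidableEq a] [Fintype b] [DecidableEq b]
  [Fintype c] [DecidableEq c] [Fintype r] [DecidableEq r] [Fintype e] [DecidableEq e]

/-- The Choi matrix of a linear map. -/
def choi : (Matrix b b ℂ →ₗ[ℂ] Matrix c c ℂ) →ₗ[ℂ] Matrix (c × b) (c × b) ℂ where
  toFun Ψ := Matrix.of fun p q => Ψ (Matrix.single p.2 q.2 1) p.1 q.1
  map_add' _ _ := rfl
  map_smul' _ _ := rfl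

theorem choi_apply (Ψ : Matrix b b ℂ →ₗ[ℂ] Matrix c c ℂ) (p q : c × b) :
    choi Ψ p q = Ψ (Matrix.single p.2 q.2 1) p.1 q.1 := rfl

theorem apply_eq_sum_choi (Ψ : Matrix b b ℂ →ₗ[ℂ] Matrix c c ℂ) (X : Matrix b b ℂ) (i j : c) :
    Ψ X i j = ∑ k, ∑ l, X k l * choi Ψ (i, k) (j, l) := by
  conv_lhs => rw [matrix_eq_sum_single X]
  simp only [map_sum, Matrix.sum_apply, choi_apply]
  refine Finset.sum_congr rfl fun k _ => Finset.sum_congr rfl fun l _ => ?_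
  have : Matrix.single k l (X k l) = X k l • Matrix.single k l (1 : ℂ) := by simp
  rw [this, map_smul]
  rfl

theorem tensorId_apply (Ψ : Matrix b b ℂ →ₗ[ℂ] Matrix c c ℂ) (X : Matrix (b × r) (b × r) ℂ)
    (p q : c × r) : tensorId r Ψ X p q =
      ∑ k, ∑ l, X (k, p.2) (l, q.2) * choi Ψ (p.1, k) (q.1, l) :=
  apply_eq_sum_choi Ψ _ _ _

theorem tensorId_sub (Ψ Θ : Matrix b b ℂ →ₗ[ℂ] Matrix c c ℂ) (X : Matrix (b × r) (b × r) ℂ) :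
    tensorId r (Ψ - Θ) X = tensorId r Ψ X - tensorId r Θ X := rfl

theorem tensorId_comp (Ψ : Matrix b b ℂ →ₗ[ℂ] Matrix c c ℂ) (Θ : Matrix a a ℂ →ₗ[ℂ] Matrix b b ℂ)
    (X : Matrix (a × r) (a × r) ℂ) : tensorId r (Ψ ∘ₗ Θ) X = tensorId r Ψ (tensorId r Θ X) := rfl

/-- The (unnormalized) pure state given by the matrix of coefficients of a vector. -/
def pureState (K : Matrix r b ℂ) : Matrix (b × r) (b × r) ℂ :=
  Matrix.of fun p q => K p.2 p.1 * star (K q.2 q.1)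

theorem pureState_apply (K : Matrix r b ℂ) (p q : b × r) :
    pureState K p q = K p.2 p.1 * star (K q.2 q.1) := rfl

theorem pureState_posSemidef (K : Matrix r b ℂ) : (pureState K).PosSemidef :=
  posSemidef_vecMulVec_self_star fun p : b × r => K p.2 p.1

theorem trace_pureState (K : Matrix r b ℂ) : (pureState K).trace = (Kᴴ * K).trace := by
  simp [trace, pureState_apply, Fintype.sum_prod_type, Matrix.mul_apply, mul_comm]

theorem restrictRight_pureState (K : Matrix r b ℂ) : restrictRight (pureState K) = K * Kᴴ := by
  ext k l
  simp [restrictRight, pureState_apply, Matrix.mul_apply]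

/-- A positive matrix on a composite system is a sum of pure states. -/
theorem exists_sum_pureState {ρ : Matrix (b × r) (b × r) ℂ} (hρ : ρ.PosSemidef) :
    ∃ K : b × r → Matrix r b ℂ, ρ = ∑ x, pureState (K x) := by
  obtain ⟨G, rfl⟩ := exists_eq_mul_conjTranspose hρ
  refine ⟨fun x => Matrix.of fun k i => G (i, k) x, ?_⟩
  ext p q
  simp [Matrix.sum_apply, pureState_apply, Matrix.mul_apply]

theorem tensorId_pureState (Ψ : Matrix b b ℂ →ₗ[ℂ] Matrix c c ℂ) (K : Matrix r b ℂ) :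
    tensorId r Ψ (pureState K) =
      ((1 : Matrix c c ℂ) ⊗ₖ K) * choi Ψ * ((1 : Matrix c c ℂ) ⊗ₖ K)ᴴ := by
  ext p q
  rw [tensorId_apply]
  simp only [Matrix.mul_apply, Fintype.sum_prod_type, kroneckerMap_apply, one_apply,
    conjTranspose_apply, pureState_apply, ite_mul, one_mul, zero_mul, Finset.sum_ite_irrel,
    Finset.sum_const_zero, Finset.sum_ite_eq, Finset.mem_univ, if_true, apply_ite star, star_zero,
    mul_ite, mul_zero]
  rw [Finset.sum_comm]
  refine Finset.sum_congr rfl fun l _ => ?_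
  rw [Finset.sum_mul]
  exact Finset.sum_congr rfl fun k _ => by ring

theorem trace_mul_tensorId_pureState (T : Matrix (c × r) (c × r) ℂ)
    (Ψ : Matrix b b ℂ →ₗ[ℂ] Matrix c c ℂ) (K : Matrix r b ℂ) :
    (T * tensorId r Ψ (pureState K)).trace =
      (((1 : Matrix c c ℂ) ⊗ₖ K)ᴴ * T * ((1 : Matrix c c ℂ) ⊗ₖ K) * choi Ψ).trace := by
  rw [tensorId_pureState, ← Matrix.mul_assoc, trace_mul_comm]
  simp only [Matrix.mul_assoc]

/-- The pairs of operators dual to the diamond norm. -/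
def tests (b c : Type*) [Fintype b] [DecidableEq b] [Fintype c] [DecidableEq c] :
    Set (Matrix (c × b) (c × b) ℂ × Matrix b b ℂ) :=
  {p | p.2.PosDef ∧ p.2.trace = 1 ∧ ((1 : Matrix c c ℂ) ⊗ₖ p.2 - p.1).PosSemidef ∧
    ((1 : Matrix c c ℂ) ⊗ₖ p.2 + p.1).PosSemidef}

theorem convex_tests : Convex ℝ (tests b c) := by
  rintro ⟨T, σ⟩ ⟨h1, h2, h3, h4⟩ ⟨T', σ'⟩ ⟨h1', h2', h3', h4'⟩ x y hx hy hxy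
  dsimp only at *
  refine ⟨?_, ?_, ?_, ?_⟩
  · change (x • σ + y • σ').PosDef
    rcases hx.eq_or_lt with rfl | hx
    · obtain rfl : y = 1 := by linarith
      simpa using h1'
    · exact (h1.smul hx).add_posSemidef (h1'.posSemidef.smul hy)
  · change (x • σ + y • σ').trace = 1
    rw [trace_add, trace_smul, trace_smul, h2, h2', ← add_smul, hxy, one_smul]
  · have := (h3.smul hx).add (h3'.smul hy)
    convert this using 1
    simp only [Prod.fst_add, Prod.snd_add, Prod.smul_fst, Prod.smul_snd, kronecker_add,
      kronecker_smul, smul_sub]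
    abel
  · have := (h4.smul hx).add (h4'.smul hy)
    convert this using 1
    simp only [Prod.fst_add, Prod.snd_add, Prod.smul_fst, Prod.smul_snd, kronecker_add,
      kronecker_smul, smul_add]
    abel

theorem exists_test_of_state {ρ : Matrix (b × r) (b × r) ℂ} (hρ : ρ.PosSemidef)
    {T : Matrix (c × r) (c × r) ℂ} (h₁ : (1 - T).PosSemidef) (h₂ : (1 + T).PosSemidef) :
    ∃ (T' : Matrix (c × b) (c × b) ℂ) (σ : Matrix b b ℂ), σ.PosSemidef ∧ σ.trace = ρ.trace ∧
      ((1 : Matrix c c ℂ) ⊗ₖ σ - T').PosSemidef ∧ ((1 : Matrix c c ℂ) ⊗ₖ σ + T').PosSemidef ∧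
      ∀ Ψ : Matrix b b ℂ →ₗ[ℂ] Matrix c c ℂ,
        (T * tensorId r Ψ ρ).trace = (T' * choi Ψ).trace := by
  obtain ⟨K, rfl⟩ := exists_sum_pureState hρ
  have hσ : (1 : Matrix c c ℂ) ⊗ₖ (∑ x, (K x)ᴴ * K x) =
      ∑ x, ((1 : Matrix c c ℂ) ⊗ₖ K x)ᴴ * (1 : Matrix (c × r) (c × r) ℂ) * ((1 : Matrix c c ℂ) ⊗ₖ K x) := by
    have : ∀ s : Finset (b × r), (1 : Matrix c c ℂ) ⊗ₖ (∑ x ∈ s, (K x)ᴴ * K x) =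
        ∑ x ∈ s, ((1 : Matrix c c ℂ) ⊗ₖ K x)ᴴ * (1 : Matrix (c × r) (c × r) ℂ) * ((1 : Matrix c c ℂ) ⊗ₖ K x) := by
      intro s
      induction s using Finset.induction_on with
      | empty => simp
      | insert x s hx ih =>
        rw [Finset.sum_insert hx, Finset.sum_insert hx, kronecker_add, ih, Matrix.mul_one,
          conjTranspose_kronecker, ← mul_kronecker_mul, conjTranspose_one, Matrix.one_mul]
    exact this _
  refine ⟨∑ x, ((1 : Matrix c c ℂ) ⊗ₖ K x)ᴴ * T * ((1 : Matrix c c ℂ) ⊗ₖ K x),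
    ∑ x, (K x)ᴴ * K x, posSemidef_sum _ fun x _ => posSemidef_conjTranspose_mul_self _, ?_, ?_, ?_,
    fun Ψ => ?_⟩
  · rw [trace_sum, trace_sum]
    exact Finset.sum_congr rfl fun x _ => (trace_pureState _).symm
  · rw [hσ, ← Finset.sum_sub_distrib]
    refine posSemidef_sum _ fun x _ => ?_
    rw [← Matrix.sub_mul, ← Matrix.mul_sub]
    exact h₁.conjTranspose_mul_mul_same _
  · rw [hσ, ← Finset.sum_add_distrib]
    refine posSemidef_sum _ fun x _ => ?_
    rw [← Matrix.add_mul, ← Matrix.mul_add]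
    exact h₂.conjTranspose_mul_mul_same _
  · rw [map_sum, Matrix.mul_sum, Finset.sum_mul, trace_sum, trace_sum]
    exact Finset.sum_congr rfl fun x _ => trace_mul_tensorId_pureState _ _ _

theorem exists_state_of_test (hc : Fintype.card b ≤ Fintype.card r)
    {p : Matrix (c × b) (c × b) ℂ × Matrix b b ℂ} (hp : p ∈ tests b c) :
    ∃ (T : Matrix (c × r) (c × r) ℂ) (M : Matrix r b ℂ), (1 - T).PosSemidef ∧
      (1 + T).PosSemidef ∧ (Mᴴ * M).trace = 1 ∧
      ∀ Ψ : Matrix b b ℂ →ₗ[ℂ] Matrix c c ℂ,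
        (T * tensorId r Ψ (pureState M)).trace = (p.1 * choi Ψ).trace := by
  obtain ⟨T, σ⟩ := p
  obtain ⟨h1, h2, h3, h4⟩ := hp
  dsimp only at *
  obtain ⟨W, hW⟩ := exists_coisometry (m := b) (n := r) hc
  set S := CFC.sqrt σ with hS
  have hSh : Sᴴ = S := (sqrt_posSemidef σ).isHermitian.eq
  have hSS : S * S = σ := sqrt_mul_sqrt h1.posSemidef
  have hSu : IsUnit S := isUnit_of_mul_isUnit_left (hSS ▸ h1.isUnit)
  have hSd : IsUnit S.det := (Matrix.isUnit_iff_isUnit_det S).1 hSu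
  set V : Matrix (c × r) (c × b) ℂ := (1 : Matrix c c ℂ) ⊗ₖ (Wᴴ * S⁻¹) with hV
  have hproj : ((1 : Matrix (c × r) (c × r) ℂ) - (1 : Matrix c c ℂ) ⊗ₖ (Wᴴ * W)).PosSemidef := by
    have : (1 : Matrix (c × r) (c × r) ℂ) - (1 : Matrix c c ℂ) ⊗ₖ (Wᴴ * W) =
        (1 : Matrix c c ℂ) ⊗ₖ (1 - Wᴴ * W) := by
      rw [← one_kronecker_one, sub_eq_iff_eq_add, ← kronecker_add, sub_add_cancel]
    rw [this]
    refine PosSemidef.one.kronecker ?_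
    have h : 1 - Wᴴ * W = (1 - Wᴴ * W) * (1 - Wᴴ * W)ᴴ := by
      rw [conjTranspose_sub, conjTranspose_one, conjTranspose_mul, conjTranspose_conjTranspose]
      have : Wᴴ * W * (Wᴴ * W) = Wᴴ * W := by
        rw [Matrix.mul_assoc, ← Matrix.mul_assoc W, hW, Matrix.one_mul]
      rw [sub_mul, mul_sub, mul_sub, this]
      simp
    rw [h]
    exact posSemidef_self_mul_conjTranspose _
  have hVσ : V * ((1 : Matrix c c ℂ) ⊗ₖ σ) * Vᴴ = (1 : Matrix c c ℂ) ⊗ₖ (Wᴴ * W) := by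
    rw [hV, conjTranspose_kronecker, ← mul_kronecker_mul, ← mul_kronecker_mul, conjTranspose_mul,
      conjTranspose_nonsing_inv, hSh, ← hSS, conjTranspose_conjTranspose]
    congr 1
    · simp
    · rw [Matrix.mul_assoc Wᴴ, ← Matrix.mul_assoc S⁻¹, Matrix.nonsing_inv_mul _ hSd, Matrix.one_mul,
        Matrix.mul_assoc Wᴴ, ← Matrix.mul_assoc S, Matrix.mul_nonsing_inv _ hSd, Matrix.one_mul]
  refine ⟨V * T * Vᴴ, Wᴴ * S, ?_, ?_, ?_, fun Ψ => ?_⟩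
  · have := hproj.add (h3.mul_mul_conjTranspose_same V)
    rw [Matrix.mul_sub, Matrix.sub_mul, hVσ] at this
    convert this using 1
    abel
  · have := hproj.add (h4.mul_mul_conjTranspose_same V)
    rw [Matrix.mul_add, Matrix.add_mul, hVσ] at this
    convert this using 1
    abel
  · rw [conjTranspose_mul, conjTranspose_conjTranspose, hSh, Matrix.mul_assoc,
      ← Matrix.mul_assoc W, hW, Matrix.one_mul, hSS, h2]
  · rw [trace_mul_tensorId_pureState]
    have hK : Vᴴ * ((1 : Matrix c c ℂ) ⊗ₖ (Wᴴ * S)) = 1 := by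
      rw [hV, conjTranspose_kronecker, ← mul_kronecker_mul, conjTranspose_mul,
        conjTranspose_nonsing_inv, hSh, conjTranspose_conjTranspose, Matrix.mul_assoc,
        ← Matrix.mul_assoc W, hW, Matrix.one_mul, Matrix.nonsing_inv_mul _ hSd]
      simp
    have hK' := congrArg conjTranspose hK
    rw [conjTranspose_mul, conjTranspose_conjTranspose, conjTranspose_one] at hK'
    have : ((1 : Matrix c c ℂ) ⊗ₖ (Wᴴ * S))ᴴ * (V * T * Vᴴ) * ((1 : Matrix c c ℂ) ⊗ₖ (Wᴴ * S))
        = T := by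
      rw [Matrix.mul_assoc, Matrix.mul_assoc (V * T), hK, Matrix.mul_one, ← Matrix.mul_assoc, hK',
        Matrix.one_mul]
    rw [this]

/-- A bound on all tests bounds the trace norm on all states, for every ancilla. -/
theorem traceNorm_tensorId_le_of_tests {Ψ : Matrix b b ℂ →ₗ[ℂ] Matrix c c ℂ} {ε : ℝ}
    (h : ∀ p ∈ tests b c, (p.1 * choi Ψ).trace.re ≤ ε) {ρ : Matrix (b × r) (b × r) ℂ}
    (hρ : ρ ∈ states (b × r)) (hh : (tensorId r Ψ ρ).IsHermitian) :
    traceNorm (tensorId r Ψ ρ) ≤ ε := by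
  obtain ⟨S, hS, hSS, hn⟩ := exists_reflection hh
  obtain ⟨T, σ, h1, h2, h3, h4, h5⟩ := exists_test_of_state (c := c) hρ.1
    (posSemidef_one_sub_of_mul_self hS hSS) (posSemidef_one_add_of_mul_self hS hSS)
  rw [hρ.2] at h2
  rw [← hn, h5]
  have key : ∀ η : ℝ, 0 < η → (T * choi Ψ).trace.re ≤ (1 + η * Fintype.card b) * ε := by
    intro η hη
    have hd : (0 : ℝ) < 1 + η * Fintype.card b := by positivity
    have hη1 : (η • (1 : Matrix b b ℂ)).PosDef := PosDef.one.smul hη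
    have hη2 : (η • ((1 : Matrix c c ℂ) ⊗ₖ (1 : Matrix b b ℂ))).PosSemidef :=
      (PosSemidef.one.kronecker PosSemidef.one).smul hη.le
    have := h ((1 + η * Fintype.card b)⁻¹ • T, (1 + η * Fintype.card b)⁻¹ • (σ + η • 1)) ?_
    · dsimp only at this
      rw [smul_mul_assoc, trace_smul, Complex.smul_re, smul_eq_mul, inv_mul_le_iff₀ hd] at this
      exact this
    · refine ⟨(hη1.posSemidef_add h1).smul (inv_pos.2 hd), ?_, ?_, ?_⟩
      · dsimp only
        rw [trace_smul, trace_add, trace_smul, trace_one, h2, Complex.real_smul, Complex.real_smul]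
        have : (1 + (η : ℂ) * Fintype.card b) ≠ 0 := by exact_mod_cast hd.ne'
        push_cast
        field_simp
      · convert (h3.add hη2).smul (inv_nonneg.2 hd.le) using 1
        simp only [kronecker_smul, kronecker_add, smul_sub, smul_add]
        abel
      · convert (h4.add hη2).smul (inv_nonneg.2 hd.le) using 1
        simp only [kronecker_smul, kronecker_add, smul_add]
        abel
  refine ge_of_tendsto (f := fun η : ℝ => (1 + η * Fintype.card b) * ε)
    (x := nhdsWithin 0 (Set.Ioi 0)) ?_ (eventually_mem_nhdsWithin.mono key)
  refine Filter.Tendsto.mono_left ?_ nhdsWithin_le_nhds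
  have : Continuous fun η : ℝ => (1 + η * Fintype.card b) * ε := by fun_prop
  simpa using this.tendsto 0

end Choi

section Channels

variable {a b c r e : Type*} [Fintype a] [DecidableEq a] [Fintype b] [DecidableEq b]
  [Fintype c] [DecidableEq c] [Fintype r] [DecidableEq r] [Fintype e] [DecidableEq e]

theorem IsCompletelyPositive.tensorId_posSemidef {Φ : Matrix a a ℂ →ₗ[ℂ] Matrix b b ℂ}
    (hΦ : IsCompletelyPositive Φ) {X : Matrix (a × r) (a × r) ℂ} (hX : X.PosSemidef) :
    (tensorId r Φ X).PosSemidef :=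
  (hΦ _ _ (hX.submatrix (Prod.map id (Fintype.equivFin r).symm))).submatrix
      (Prod.map id (Fintype.equivFin r)) |> fun h => by
    convert h using 1
    ext p q
    simp [tensorId]

theorem restrictRight_tensorId {Φ : Matrix a a ℂ →ₗ[ℂ] Matrix b b ℂ}
    (hΦ : ∀ X, (Φ X).trace = X.trace) (X : Matrix (a × r) (a × r) ℂ) :
    restrictRight (tensorId r Φ X) = restrictRight X := by
  ext k l
  exact hΦ (Matrix.of fun i j => X (i, k) (j, l))

theorem trace_restrictRight (X : Matrix (a × r) (a × r) ℂ) :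
    (restrictRight X).trace = X.trace := by
  simp only [trace, restrictRight, diag_apply, of_apply, Fintype.sum_prod_type]
  exact Finset.sum_comm

theorem trace_tensorId {Φ : Matrix a a ℂ →ₗ[ℂ] Matrix b b ℂ}
    (hΦ : ∀ X, (Φ X).trace = X.trace) (X : Matrix (a × r) (a × r) ℂ) :
    (tensorId r Φ X).trace = X.trace := by
  rw [← trace_restrictRight, restrictRight_tensorId hΦ, trace_restrictRight]

theorem tensorId_mem_states {Φ : Matrix a a ℂ →ₗ[ℂ] Matrix b b ℂ} (hΦ : Φ ∈ channels a b)
    {ρ : Matrix (a × r) (a × r) ℂ} (hρ : ρ ∈ states (a × r)) : tensorId r Φ ρ ∈ states (b × r) :=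
  ⟨hΦ.1.tensorId_posSemidef hρ.1, by rw [trace_tensorId hΦ.2, hρ.2]⟩

theorem comp_mem_channels {Φ : Matrix b b ℂ →ₗ[ℂ] Matrix c c ℂ}
    {Λ : Matrix a a ℂ →ₗ[ℂ] Matrix b b ℂ} (hΦ : Φ ∈ channels b c) (hΛ : Λ ∈ channels a b) :
    Φ ∘ₗ Λ ∈ channels a c :=
  ⟨fun n X hX => hΦ.1 n _ (hΛ.1 n X hX), fun X => (hΦ.2 _).trans (hΛ.2 X)⟩

theorem restrictRight_posSemidef {X : Matrix (a × r) (a × r) ℂ} (hX : X.PosSemidef) :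
    (restrictRight X).PosSemidef := by
  obtain ⟨K, rfl⟩ := exists_sum_pureState hX
  have : restrictRight (∑ x, pureState (K x)) = ∑ x, K x * (K x)ᴴ := by
    simp only [← restrictRight_pureState]
    ext k l
    simp only [restrictRight, of_apply, Matrix.sum_apply]
    exact Finset.sum_comm
  rw [this]
  exact posSemidef_sum _ fun x _ => posSemidef_self_mul_conjTranspose _

theorem restrictRight_mem_states {ρ : Matrix (a × r) (a × r) ℂ} (hρ : ρ ∈ states (a × r)) :
    restrictRight ρ ∈ states r :=
  ⟨restrictRight_posSemidef hρ.1, by rw [trace_restrictRight, hρ.2]⟩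

/-- The completely positive map with the given Kraus operators. -/
def krausMap (F : e → Matrix a b ℂ) : Matrix b b ℂ →ₗ[ℂ] Matrix a a ℂ where
  toFun X := ∑ x, F x * X * (F x)ᴴ
  map_add' X Y := by simp [Matrix.mul_add, Matrix.add_mul, Finset.sum_add_distrib]
  map_smul' z X := by simp [Finset.smul_sum]

theorem krausMap_apply (F : e → Matrix a b ℂ) (X : Matrix b b ℂ) :
    krausMap F X = ∑ x, F x * X * (F x)ᴴ := rfl

theorem choi_krausMap (F : e → Matrix a b ℂ) :
    choi (krausMap F) = ∑ x, Matrix.of fun p q : a × b => F x p.1 p.2 * star (F x q.1 q.2) := by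
  ext p q
  simp only [choi_apply, krausMap_apply, Matrix.sum_apply, of_apply]
  refine Finset.sum_congr rfl fun x _ => ?_
  simp [Matrix.mul_apply, Matrix.single_apply, ite_and]

theorem tensorId_krausMap (F : e → Matrix a b ℂ) (X : Matrix (b × r) (b × r) ℂ) :
    tensorId r (krausMap F) X =
      ∑ x, (F x ⊗ₖ (1 : Matrix r r ℂ)) * X * (F x ⊗ₖ (1 : Matrix r r ℂ))ᴴ := by
  ext p q
  change krausMap F (Matrix.of fun i j => X (i, p.2) (j, q.2)) p.1 q.1 = _
  rw [krausMap_apply]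
  simp only [Matrix.sum_apply]
  refine Finset.sum_congr rfl fun x _ => ?_
  simp [Matrix.mul_apply, Fintype.sum_prod_type, kroneckerMap_apply, one_apply,
    apply_ite (starRingEnd ℂ)]

theorem krausMap_isCompletelyPositive (F : e → Matrix a b ℂ) :
    IsCompletelyPositive (krausMap F) := fun n X hX => by
  rw [tensorId_krausMap]
  exact posSemidef_sum _ fun x _ => hX.mul_mul_conjTranspose_same _

theorem krausMap_mem_channels {F : e → Matrix a b ℂ} (hF : ∑ x, (F x)ᴴ * F x = 1) :
    krausMap F ∈ channels b a := by
  refine ⟨krausMap_isCompletelyPositive F, fun X => ?_⟩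
  rw [krausMap_apply, trace_sum]
  conv_rhs => rw [← Matrix.one_mul X, ← hF, Finset.sum_mul, trace_sum]
  refine Finset.sum_congr rfl fun x _ => ?_
  rw [trace_mul_comm, ← Matrix.mul_assoc]

/-- The linear map with the given Choi matrix. -/
def choiMap : Matrix (a × b) (a × b) ℂ →ₗ[ℂ] Matrix b b ℂ →ₗ[ℂ] Matrix a a ℂ where
  toFun J :=
    { toFun := fun X => Matrix.of fun i j => ∑ k, ∑ l, X k l * J (i, k) (j, l)
      map_add' := fun X Y => by
        ext i j
        simp [add_mul, Finset.sum_add_distrib]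
      map_smul' := fun z X => by
        ext i j
        simp [Finset.mul_sum, mul_assoc] }
  map_add' J J' := by
    ext X i j
    simp [mul_add, Finset.sum_add_distrib]
  map_smul' z J := by
    ext X i j
    simp [Finset.mul_sum, mul_left_comm]

theorem choiMap_apply (J : Matrix (a × b) (a × b) ℂ) (X : Matrix b b ℂ) (i j : a) :
    choiMap J X i j = ∑ k, ∑ l, X k l * J (i, k) (j, l) := rfl

theorem choiMap_choi (Λ : Matrix b b ℂ →ₗ[ℂ] Matrix a a ℂ) : choiMap (choi Λ) = Λ := by
  refine LinearMap.ext fun X => ?_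
  ext i j
  rw [choiMap_apply, ← apply_eq_sum_choi]

/-- The set of Choi matrices of channels. -/
def choiSet (a b : Type*) [Fintype a] [Fintype b] [DecidableEq b] :
    Set (Matrix (a × b) (a × b) ℂ) :=
  {J | J.PosSemidef ∧ restrictRight J = 1}

theorem choiMap_mem_channels {J : Matrix (a × b) (a × b) ℂ} (hJ : J ∈ choiSet a b) :
    choiMap J ∈ channels b a := by
  obtain ⟨G, hG⟩ := exists_eq_mul_conjTranspose hJ.1
  set F : a × b → Matrix a b ℂ := fun x => Matrix.of fun i k => G (i, k) x with hF
  have h : choi (krausMap F) = J := by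
    rw [choi_krausMap, hG]
    ext p q
    simp [hF, Matrix.sum_apply, Matrix.mul_apply]
  rw [← h, choiMap_choi]
  refine krausMap_mem_channels ?_
  have h' := hJ.2
  rw [← h, choi_krausMap] at h'
  rw [← transpose_inj, transpose_one, ← h']
  ext k l
  simp only [restrictRight, transpose_apply, Matrix.sum_apply, Matrix.mul_apply, of_apply,
    conjTranspose_apply]
  rw [Finset.sum_comm]
  exact Finset.sum_congr rfl fun i _ => Finset.sum_congr rfl fun x _ => mul_comm _ _

theorem choi_mem_choiSet {Λ : Matrix b b ℂ →ₗ[ℂ] Matrix a a ℂ} (hΛ : Λ ∈ channels b a) :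
    choi Λ ∈ choiSet a b := by
  constructor
  · have h := tensorId_pureState Λ (1 : Matrix b b ℂ)
    rw [one_kronecker_one, conjTranspose_one, Matrix.one_mul, Matrix.mul_one] at h
    rw [← h]
    exact hΛ.1.tensorId_posSemidef (pureState_posSemidef _)
  · ext k l
    have := hΛ.2 (Matrix.single k l 1)
    simp only [restrictRight, of_apply, choi_apply]
    rw [trace] at this
    simp only [diag_apply] at this
    rw [this]
    by_cases h : k = l
    · subst h; simp
    · simp [h]

theorem channels_nonempty [Nonempty a] : (channels b a).Nonempty := by
  obtain ⟨i⟩ := ‹Nonempty a›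
  refine ⟨krausMap fun x : b => Matrix.single i x 1, krausMap_mem_channels ?_⟩
  simp only [conjTranspose_single, single_mul_single_same, star_one, mul_one]
  ext k l
  simp [Matrix.sum_apply, Matrix.single_apply, one_apply, ite_and]

/-- Uhlmann's theorem: some channel maps a given pure state to a state having a purification whose
overlap with a purification of a given state is the fidelity of the restrictions. -/
theorem exists_channel_fidelity_eq [Nonempty a] (hc : Fintype.card b ≤ Fintype.card r)
    (M : Matrix r b ℂ) {ω : Matrix (a × r) (a × r) ℂ}
    (hω : ω ∈ states (a × r)) :
    ∃ Λ ∈ channels b a, ∃ G H : Matrix (a × r) (a × r) ℂ, ω = G * Gᴴ ∧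
      tensorId r Λ (pureState M) = H * Hᴴ ∧
      (Gᴴ * H).trace.re = fidelity (restrictRight ω) (restrictRight (pureState M)) := by
  obtain ⟨G, hG⟩ := exists_eq_mul_conjTranspose hω.1
  have hcr : Fintype.card r ≤ Fintype.card (a × (a × r)) := by
    rw [Fintype.card_prod, Fintype.card_prod, ← mul_assoc]
    exact Nat.le_mul_of_pos_left _ (Nat.mul_pos Fintype.card_pos Fintype.card_pos)
  set N : Matrix r (a × (a × r)) ℂ := Matrix.of fun k x => G (x.1, k) x.2 with hN
  set τ := restrictRight ω with hτ
  set σ := restrictRight (pureState M) with hσ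
  have hτp : τ.PosSemidef := restrictRight_posSemidef hω.1
  have hσp : σ.PosSemidef := restrictRight_posSemidef (pureState_posSemidef M)
  have hσM : σ = M * Mᴴ := restrictRight_pureState M
  have hNN : N * Nᴴ = τ := by
    rw [hτ, hG]
    ext k l
    simp [hN, restrictRight, Matrix.mul_apply, Fintype.sum_prod_type]
  obtain ⟨U, hU, hUn⟩ := exists_unitary_trace_mul (CFC.sqrt τ * CFC.sqrt σ)
  obtain ⟨Z, hZ, hZN⟩ := exists_coisometry_of_mul_conjTranspose_eq hcr
    (M := CFC.sqrt τ) (N := N) (by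
      rw [(sqrt_posSemidef τ).isHermitian.eq, sqrt_mul_sqrt hτp, hNN])
  have hL : M * Mᴴ = (CFC.sqrt σ * U * Z) * (CFC.sqrt σ * U * Z)ᴴ := by
    rw [conjTranspose_mul, conjTranspose_mul, (sqrt_posSemidef σ).isHermitian.eq]
    calc M * Mᴴ = CFC.sqrt σ * CFC.sqrt σ := by rw [sqrt_mul_sqrt hσp, hσM]
      _ = CFC.sqrt σ * (U * ((Z * Zᴴ) * Uᴴ)) * CFC.sqrt σ := by
        rw [hZ, Matrix.one_mul, hU, Matrix.mul_one]
      _ = _ := by simp only [Matrix.mul_assoc]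
  obtain ⟨Y, hY, hYM⟩ := exists_coisometry_of_mul_conjTranspose_eq (hc.trans hcr) hL
  refine ⟨krausMap fun x : a × r => Matrix.of fun i k => Y k (i, x), krausMap_mem_channels ?_, G,
    Matrix.of fun p x => (M * Y) p.2 (p.1, x), hG, ?_, ?_⟩
  · rw [← transpose_inj, transpose_one, ← hY]
    ext k l
    simp only [transpose_apply, Matrix.sum_apply, Matrix.mul_apply, of_apply, conjTranspose_apply,
      Fintype.sum_prod_type (f := fun x : a × a × r => Y k x * star (Y l x))]
    rw [Finset.sum_comm]
    exact Finset.sum_congr rfl fun i _ => Finset.sum_congr rfl fun x _ => mul_comm _ _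
  · rw [tensorId_krausMap]
    ext p q
    rw [Matrix.sum_apply, Matrix.mul_apply]
    refine Finset.sum_congr rfl fun x _ => ?_
    simp only [Matrix.mul_apply, Fintype.sum_prod_type, kroneckerMap_apply, one_apply,
      conjTranspose_apply, of_apply, pureState_apply, mul_ite, mul_one, mul_zero, ite_mul, zero_mul,
      Finset.sum_ite_eq, Finset.mem_univ, if_true, apply_ite star, star_zero, star_sum, star_mul]
    rw [Finset.sum_mul_sum, Finset.sum_comm]
    simp only [Finset.sum_mul]
    exact Finset.sum_congr rfl fun k _ => Finset.sum_congr rfl fun l _ => by ring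
  · have h1 : ∀ L : Matrix r (a × a × r) ℂ,
        (Gᴴ * Matrix.of fun (p : a × r) x => L p.2 (p.1, x)).trace = (Nᴴ * L).trace := by
      intro L
      simp only [trace, diag_apply, Matrix.mul_apply, conjTranspose_apply, hN, of_apply]
      rw [Fintype.sum_prod_type (f := fun x : a × a × r => ∑ k, star (G (x.1, k) x.2) * L k x),
        Finset.sum_comm]
      rw [Fintype.sum_prod_type]
      exact Finset.sum_congr rfl fun i _ => Finset.sum_comm
    rw [h1, ← hYM, hZN, conjTranspose_mul, (sqrt_posSemidef τ).isHermitian.eq, fidelity, ← hUn,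
      Matrix.mul_assoc, trace_mul_comm, trace_mul_comm U]
    simp only [Matrix.mul_assoc]
    rw [hZ, Matrix.mul_one]

/-- Preprocessing a pure state attains the distance of the ranges. -/
theorem exists_channel_traceNorm_le_stateDist [Nonempty a]
    (hc : Fintype.card b ≤ Fintype.card r)
    {Φ₁ : Matrix a a ℂ →ₗ[ℂ] Matrix c c ℂ} (hΦ₁ : Φ₁ ∈ channels a c)
    {Φ₂ : Matrix b b ℂ →ₗ[ℂ] Matrix c c ℂ} (hΦ₂ : Φ₂ ∈ channels b c)
    {M : Matrix r b ℂ} (hM : (Mᴴ * M).trace = 1) {ω : Matrix (a × r) (a × r) ℂ}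
    (hω : ω ∈ states (a × r)) :
    ∃ Λ ∈ channels b a, traceNorm (tensorId r (Φ₁ ∘ₗ Λ - Φ₂) (pureState M)) ≤
      stateDist (tensorId r Φ₁ ω) (tensorId r Φ₂ (pureState M)) := by
  obtain ⟨Λ, hΛ, G, H, hG, hH, hGH⟩ := exists_channel_fidelity_eq hc M hω
  refine ⟨Λ, hΛ, ?_⟩
  have hρ : pureState M ∈ states (b × r) :=
    ⟨pureState_posSemidef M, by rw [trace_pureState, hM]⟩
  have hω' := tensorId_mem_states hΛ hρ
  have hs := tensorId_mem_states hΦ₁ hω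
  have ht := tensorId_mem_states hΦ₂ hρ
  have hs' := tensorId_mem_states hΦ₁ hω'
  rw [tensorId_sub, tensorId_comp, stateDist, restrictRight_tensorId hΦ₁.2,
    restrictRight_tensorId hΦ₂.2, purifiedDist, ← hGH]
  have h1 : traceNorm (tensorId r Φ₁ (tensorId r Λ (pureState M)) - tensorId r Φ₁ ω) ≤
      2 * Real.sqrt (1 - (Gᴴ * H).trace.re ^ 2) := by
    rw [← neg_sub, traceNorm_neg, ← map_sub]
    have h2 := traceNorm_sub_le_of_purifications (G := G) (H := H) (by rw [← hG, hω.2])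
      (by rw [← hH, hω'.2])
    rw [← hG, ← hH] at h2
    refine le_trans ?_ h2
    obtain ⟨P, Q, -, hP, hQ, hPQ, -, -, -, hn⟩ :=
      exists_jordan (hω.1.isHermitian.sub hω'.1.isHermitian)
    rw [hn, hPQ, map_sub, trace_add, Complex.add_re, ← trace_tensorId hΦ₁.2 P,
      ← trace_tensorId hΦ₁.2 Q]
    exact traceNorm_sub_le_of_posSemidef (hΦ₁.1.tensorId_posSemidef hP)
      (hΦ₁.1.tensorId_posSemidef hQ)
  have h3 := traceNorm_add_le (hs'.1.isHermitian.sub hs.1.isHermitian)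
    (hs.1.isHermitian.sub ht.1.isHermitian)
  rw [sub_add_sub_cancel] at h3
  linarith

end Channels

section Minimax

/-- A family of convex continuous functions on a compact convex set has a common point of
nonpositivity if every convex combination of the family takes a negative value. -/
theorem exists_forall_nonpos_of_convex_combinations {V ι : Type*} [TopologicalSpace V]
    [AddCommGroup V] [Module ℝ V] {C : Set V} (hC : IsCompact C) (hCc : Convex ℝ C)
    (hne : C.Nonempty) {f : ι → V → ℝ} (hf : ∀ i, Continuous (f i))
    (hfc : ∀ i, ConvexOn ℝ C (f i))
    (h : ∀ (s : Finset ι) (w : ι → ℝ), (∀ i ∈ s, 0 ≤ w i) → ∑ i ∈ s, w i = 1 →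
      ∃ x ∈ C, ∑ i ∈ s, w i * f i x < 0) :
    ∃ x ∈ C, ∀ i, f i x ≤ 0 := by
  classical
  suffices hs : ∀ s : Finset ι, (C ∩ ⋂ i ∈ s, {x | f i x ≤ 0}).Nonempty by
    obtain ⟨x, hx, hx'⟩ := hC.inter_iInter_nonempty (fun i => {x | f i x ≤ 0})
      (fun i => isClosed_le (hf i) continuous_const) hs
    exact ⟨x, hx, fun i => Set.mem_iInter.1 hx' i⟩
  intro s
  let A : Set (s → ℝ) := {y | ∃ x ∈ C, ∀ i : s, f i x ≤ y i}
  let B : Set (s → ℝ) := Set.univ.pi fun _ => Set.Iio 0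
  by_cases hAB : Disjoint B A
  · exfalso
    have hA : Convex ℝ A := by
      rintro y ⟨x, hx, hxy⟩ y' ⟨x', hx', hxy'⟩ p q hp hq hpq
      refine ⟨p • x + q • x', hCc hx hx' hp hq hpq, fun i => ?_⟩
      refine ((hfc i).2 hx hx' hp hq hpq).trans ?_
      simp only [smul_eq_mul, Pi.add_apply, Pi.smul_apply]
      exact add_le_add (mul_le_mul_of_nonneg_left (hxy i) hp)
        (mul_le_mul_of_nonneg_left (hxy' i) hq)
    have hB : Convex ℝ B := convex_pi fun _ _ => convex_Iio 0
    have hBo : IsOpen B := isOpen_set_pi Set.finite_univ fun _ _ => isOpen_Iio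
    obtain ⟨g, u, hgB, hgA⟩ := geometric_hahn_banach_open hB hBo hA hAB
    have hg : ∀ y : s → ℝ, g y = ∑ i, y i * g (Pi.single i 1) := fun y => by
      conv_lhs => rw [pi_eq_sum_univ' y]
      simp only [map_sum, map_smul, smul_eq_mul]
    have hconst : ∀ t : ℝ, g (fun _ => t) = t * g 1 := fun t => by
      rw [← smul_eq_mul, ← map_smul]
      congr 1
      ext i
      simp
    have hu : 0 ≤ u := by
      by_contra hu
      push Not at hu
      obtain ⟨t, ht, htu⟩ : ∃ t : ℝ, t < 0 ∧ u ≤ t * g 1 := by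
        have h1 : 0 < |g 1| + 1 := by positivity
        refine ⟨u / (|g 1| + 1), div_neg_of_neg_of_pos hu h1, ?_⟩
        rw [div_mul_eq_mul_div, le_div_iff₀ h1]
        nlinarith [le_abs_self (g 1)]
      have := hgB (fun _ => t) fun _ _ => ht
      rw [hconst] at this
      linarith
    obtain ⟨x₀, hx₀⟩ := hne
    have hw : ∀ i : s, 0 ≤ g (Pi.single i 1) := by
      intro i
      by_contra hi
      push Not at hi
      have hmem : ∀ t : ℝ, 0 ≤ t → (fun j : s => f j x₀) + t • Pi.single i (1 : ℝ) ∈ A := by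
        refine fun t ht => ⟨x₀, hx₀, fun j => ?_⟩
        simp only [Pi.add_apply, Pi.smul_apply, smul_eq_mul, le_add_iff_nonneg_right]
        refine mul_nonneg ht ?_
        by_cases hij : j = i
        · subst hij; simp
        · simp [hij]
      have h0 := hgA _ (hmem 0 le_rfl)
      rw [zero_smul, add_zero] at h0
      have h1 := hgA _ (hmem ((g (fun j : s => f j x₀) - u + 1) / -g (Pi.single i 1))
        (div_nonneg (by linarith) (by linarith)))
      rw [map_add, map_smul, smul_eq_mul, div_mul_eq_mul_div, div_neg, mul_div_cancel_right₀ _ hi.ne]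
        at h1
      linarith
    have hsum : 0 < ∑ i : s, g (Pi.single i 1) := by
      refine lt_of_le_of_ne (Finset.sum_nonneg fun i _ => hw i) fun h0 => ?_
      have hz : ∀ y, g y = 0 := fun y => by
        rw [hg]
        refine Finset.sum_eq_zero fun i _ => ?_
        rw [(Finset.sum_eq_zero_iff_of_nonneg fun i _ => hw i).1 h0.symm i (Finset.mem_univ i),
          mul_zero]
      have h1 := hgB (fun _ => -1) fun _ _ => by simp
      have h2 := hgA (fun j : s => f j x₀) ⟨x₀, hx₀, fun _ => le_rfl⟩
      rw [hz] at h1 h2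
      linarith
    set W := ∑ i : s, g (Pi.single i 1) with hW
    obtain ⟨x, hx, hxlt⟩ := h s (fun i => if hi : i ∈ s then g (Pi.single ⟨i, hi⟩ 1) / W else 0)
      (fun i hi => by
        rw [dif_pos hi]
        exact div_nonneg (hw _) hsum.le)
      (by
        rw [← Finset.sum_coe_sort]
        simp only [Finset.coe_mem, dif_pos, Subtype.coe_eta]
        rw [← Finset.sum_div, div_self hsum.ne'])
    rw [← Finset.sum_coe_sort] at hxlt
    simp only [Finset.coe_mem, dif_pos, Subtype.coe_eta] at hxlt
    have h2 := hgA (fun j : s => f j x) ⟨x, hx, fun _ => le_rfl⟩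
    rw [hg] at h2
    have h3 : ∑ i : s, g (Pi.single i 1) / W * f i x =
        (∑ i : s, f i x * g (Pi.single i 1)) / W := by
      rw [Finset.sum_div]
      exact Finset.sum_congr rfl fun i _ => by ring
    rw [h3] at hxlt
    exact absurd hxlt (not_lt.2 (div_nonneg (hu.trans h2) hsum.le))
  · obtain ⟨y, hyB, x, hx, hxy⟩ := Set.not_disjoint_iff.1 hAB
    refine ⟨x, hx, Set.mem_iInter₂.2 fun i hi => ?_⟩
    exact (hxy ⟨i, hi⟩).trans (hyB ⟨i, hi⟩ (Set.mem_univ _)).le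

end Minimax

section Compactness

variable {a b n : Type*} [Fintype a] [DecidableEq a] [Fintype b] [DecidableEq b]
  [Fintype n] [DecidableEq n]

theorem isClosed_posSemidef : IsClosed {A : Matrix n n ℂ | A.PosSemidef} := by
  simp only [posSemidef_iff_dotProduct_mulVec, Set.ofPred_and, Set.ofPred_forall]
  refine IsClosed.inter ?_ (isClosed_iInter fun x => ?_)
  · exact isClosed_eq (by fun_prop) continuous_id
  · refine isClosed_le continuous_const ?_
    simp only [dotProduct, mulVec]
    fun_prop

theorem norm_apply_le_of_posSemidef {A : Matrix n n ℂ} (hA : A.PosSemidef) (i j : n) :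
    ‖A i j‖ ≤ A.trace.re := by
  obtain ⟨G, rfl⟩ := exists_eq_mul_conjTranspose hA
  have hdiag : ∀ k, ((G * Gᴴ) k k).re = ∑ x, ‖G k x‖ ^ 2 := fun k => by
    rw [Matrix.mul_apply, Complex.re_sum]
    refine Finset.sum_congr rfl fun x _ => ?_
    rw [conjTranspose_apply, ← starRingEnd_apply, Complex.mul_conj, Complex.ofReal_re,
      Complex.normSq_eq_norm_sq]
  have hle : ∀ k, ∑ x, ‖G k x‖ ^ 2 ≤ (G * Gᴴ).trace.re := fun k => by
    rw [trace, Complex.re_sum]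
    simp only [diag_apply, hdiag]
    exact Finset.single_le_sum (f := fun k => ∑ x, ‖G k x‖ ^ 2)
      (fun k _ => Finset.sum_nonneg fun x _ => sq_nonneg _) (Finset.mem_univ k)
  calc ‖(G * Gᴴ) i j‖ ≤ ∑ x, ‖G i x‖ * ‖G j x‖ := by
        rw [Matrix.mul_apply]
        refine (norm_sum_le _ _).trans (le_of_eq (Finset.sum_congr rfl fun x _ => ?_))
        rw [conjTranspose_apply, norm_mul, norm_star]
    _ ≤ ∑ x, (‖G i x‖ ^ 2 + ‖G j x‖ ^ 2) / 2 := by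
        refine Finset.sum_le_sum fun x _ => ?_
        nlinarith [sq_nonneg (‖G i x‖ - ‖G j x‖)]
    _ ≤ _ := by
        rw [← Finset.sum_div, Finset.sum_add_distrib]
        linarith [hle i, hle j]

theorem isCompact_choiSet : IsCompact (choiSet a b) := by
  have hbox : IsCompact (Set.univ.pi fun _ : a × b => Set.univ.pi fun _ : a × b =>
      Metric.closedBall (0 : ℂ) (Fintype.card b)) :=
    isCompact_univ_pi fun _ => isCompact_univ_pi fun _ => isCompact_closedBall _ _
  refine IsCompact.of_isClosed_subset hbox ?_ ?_
  · refine isClosed_posSemidef.inter (isClosed_eq ?_ continuous_const)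
    refine continuous_matrix fun k l => ?_
    simp only [restrictRight, of_apply]
    fun_prop
  · rintro J ⟨hJ, hJ1⟩ p - q -
    rw [mem_closedBall_zero_iff]
    refine (norm_apply_le_of_posSemidef hJ p q).trans ?_
    rw [← trace_restrictRight, hJ1, trace_one]
    simp

theorem convex_choiSet : Convex ℝ (choiSet a b) := by
  rintro J ⟨hJ, hJ1⟩ J' ⟨hJ', hJ1'⟩ x y hx hy hxy
  refine ⟨(hJ.smul hx).add (hJ'.smul hy), ?_⟩
  have : restrictRight (x • J + y • J') = x • restrictRight J + y • restrictRight J' := by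
    ext k l
    simp [restrictRight, Finset.sum_add_distrib, Finset.mul_sum]
  rw [this, hJ1, hJ1', ← add_smul, hxy, one_smul]

end Compactness

section Distance

variable {a b c r : Type*} [Fintype a] [DecidableEq a] [Fintype b] [DecidableEq b]
  [Fintype c] [DecidableEq c] [Fintype r] [DecidableEq r]

theorem stateDist_nonneg (ξ σ : Matrix (a × r) (a × r) ℂ) : 0 ≤ stateDist ξ σ :=
  add_nonneg (traceNorm_nonneg _) (mul_nonneg zero_le_two (purifiedDist_nonneg _ _))

theorem stateDist_comm (ξ σ : Matrix (a × r) (a × r) ℂ) : stateDist ξ σ = stateDist σ ξ := by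
  rw [stateDist, stateDist, ← neg_sub, traceNorm_neg, purifiedDist_comm]

theorem traceNorm_sub_le_two {ξ σ : Matrix a a ℂ} (hξ : ξ ∈ states a) (hσ : σ ∈ states a) :
    traceNorm (ξ - σ) ≤ 2 := by
  have := traceNorm_sub_le_of_posSemidef hξ.1 hσ.1
  rw [hξ.2, hσ.2, Complex.one_re] at this
  linarith

theorem stateDist_le_four {ξ σ : Matrix (a × r) (a × r) ℂ} (hξ : ξ ∈ states (a × r))
    (hσ : σ ∈ states (a × r)) : stateDist ξ σ ≤ 4 := by
  have h1 := traceNorm_sub_le_two hξ hσ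
  have h2 := purifiedDist_le_one (restrictRight ξ) (restrictRight σ)
  rw [stateDist]
  linarith

theorem states_nonempty [Nonempty a] : (states a).Nonempty := by
  obtain ⟨i⟩ := ‹Nonempty a›
  refine ⟨Matrix.single i i 1 * (Matrix.single i i 1)ᴴ, posSemidef_self_mul_conjTranspose _, ?_⟩
  simp

theorem diamondNorm_nonneg (Ψ : Matrix b b ℂ →ₗ[ℂ] Matrix c c ℂ) : 0 ≤ diamondNorm Ψ :=
  Real.iSup_nonneg fun _ => traceNorm_nonneg _

theorem bddAbove_traceNorm_tensorId_sub {Φ Θ : Matrix b b ℂ →ₗ[ℂ] Matrix c c ℂ}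
    (hΦ : Φ ∈ channels b c) (hΘ : Θ ∈ channels b c) :
    BddAbove (Set.range fun ρ : states (b × r) => traceNorm (tensorId r (Φ - Θ) ρ)) := by
  refine ⟨2, ?_⟩
  rintro _ ⟨ρ, rfl⟩
  exact traceNorm_sub_le_two (tensorId_mem_states hΦ ρ.2) (tensorId_mem_states hΘ ρ.2)

/-- The diamond norm bounds the trace norm for ancillas of every dimension. -/
theorem traceNorm_tensorId_sub_le_diamondNorm {Φ Θ : Matrix b b ℂ →ₗ[ℂ] Matrix c c ℂ}
    (hΦ : Φ ∈ channels b c) (hΘ : Θ ∈ channels b c) {ρ : Matrix (b × r) (b × r) ℂ}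
    (hρ : ρ ∈ states (b × r)) : traceNorm (tensorId r (Φ - Θ) ρ) ≤ diamondNorm (Φ - Θ) := by
  refine traceNorm_tensorId_le_of_tests (fun p hp => ?_) hρ
    ((tensorId_mem_states hΦ hρ).1.isHermitian.sub (tensorId_mem_states hΘ hρ).1.isHermitian)
  obtain ⟨T, M, h₁, h₂, hM, h⟩ := exists_state_of_test (r := b) le_rfl hp
  have hM' : pureState M ∈ states (b × b) :=
    ⟨pureState_posSemidef M, by rw [trace_pureState, hM]⟩
  rw [← h]
  refine (re_trace_mul_le_traceNorm ?_ h₁ h₂).trans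
    (le_ciSup (bddAbove_traceNorm_tensorId_sub hΦ hΘ) ⟨pureState M, hM'⟩)
  exact (tensorId_mem_states hΦ hM').1.isHermitian.sub (tensorId_mem_states hΘ hM').1.isHermitian

/-- The minimax step: if every state in the range of `Φ₂ ⊗ id` is within `ε` of the range of
`Φ₁ ⊗ id`, then one preprocessing of `Φ₁` is within `ε` of `Φ₂`. -/
theorem exists_channel_diamondNorm_le [Nonempty a] (hc : Fintype.card b ≤ Fintype.card r)
    {Φ₁ : Matrix a a ℂ →ₗ[ℂ] Matrix c c ℂ} (hΦ₁ : Φ₁ ∈ channels a c)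
    {Φ₂ : Matrix b b ℂ →ₗ[ℂ] Matrix c c ℂ} (hΦ₂ : Φ₂ ∈ channels b c) {ε : ℝ} (hε : 0 ≤ ε)
    (h : ∀ ρ ∈ states (b × r), ∃ ω ∈ states (a × r),
      stateDist (tensorId r Φ₁ ω) (tensorId r Φ₂ ρ) < ε) :
    ∃ Λ ∈ channels b a, diamondNorm (Φ₁ ∘ₗ Λ - Φ₂) ≤ ε := by
  let ℓ : Matrix (c × b) (c × b) ℂ → Matrix (a × b) (a × b) ℂ →ₗ[ℝ] ℝ := fun T =>
    { toFun := fun J => (T * choi (Φ₁ ∘ₗ choiMap J)).trace.re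
      map_add' := fun J J' => by
        rw [map_add, LinearMap.comp_add, map_add, mul_add, trace_add, Complex.add_re]
      map_smul' := fun x J => by
        rw [← Complex.coe_smul, map_smul, LinearMap.comp_smul, map_smul, mul_smul_comm, trace_smul]
        simp }
  have hℓ : ∀ T J, (T * choi (Φ₁ ∘ₗ choiMap J - Φ₂)).trace.re =
      ℓ T J - (T * choi Φ₂).trace.re := fun T J => by
    rw [map_sub, mul_sub, trace_sub, Complex.sub_re]
    rfl
  obtain ⟨Λ₀, hΛ₀⟩ := channels_nonempty (a := a) (b := b)
  obtain ⟨J, hJ, hJ'⟩ := exists_forall_nonpos_of_convex_combinations (ι := tests b c)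
    (C := choiSet a b) isCompact_choiSet convex_choiSet ⟨_, choi_mem_choiSet hΛ₀⟩
    (f := fun p J => (p.1.1 * choi (Φ₁ ∘ₗ choiMap J - Φ₂)).trace.re - ε)
    (fun p => by
      simp only [hℓ]
      exact ((ℓ p.1.1).continuous_of_finiteDimensional.sub continuous_const).sub continuous_const)
    (fun p => by
      simp only [hℓ]
      exact (((ℓ p.1.1).convexOn convex_choiSet).sub (concaveOn_const _ convex_choiSet)).sub
        (concaveOn_const _ convex_choiSet))
    (fun s w hw hw1 => by
      have hq := convex_tests.sum_mem hw hw1 fun p (_ : p ∈ s) => p.2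
      obtain ⟨T, M, h₁, h₂, hM, hT⟩ := exists_state_of_test hc hq
      have hρ : pureState M ∈ states (b × r) :=
        ⟨pureState_posSemidef M, by rw [trace_pureState, hM]⟩
      obtain ⟨ω, hω, hlt⟩ := h _ hρ
      obtain ⟨Λ, hΛ, hle⟩ := exists_channel_traceNorm_le_stateDist hc hΦ₁ hΦ₂ hM hω
      refine ⟨choi Λ, choi_mem_choiSet hΛ, ?_⟩
      have hherm : (tensorId r (Φ₁ ∘ₗ Λ - Φ₂) (pureState M)).IsHermitian :=
        (tensorId_mem_states (comp_mem_channels hΦ₁ hΛ) hρ).1.isHermitian.sub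
          (tensorId_mem_states hΦ₂ hρ).1.isHermitian
      have hlt' := (re_trace_mul_le_traceNorm hherm h₁ h₂).trans_lt (hle.trans_lt hlt)
      rw [hT, Prod.fst_sum, Finset.sum_mul, trace_sum, Complex.re_sum] at hlt'
      simp only [choiMap_choi, mul_sub, Finset.sum_sub_distrib, ← Finset.sum_mul, hw1, one_mul]
      refine sub_neg.2 (lt_of_eq_of_lt (Finset.sum_congr rfl fun p _ => ?_) hlt')
      rw [Prod.smul_fst, smul_mul_assoc, trace_smul, Complex.smul_re, smul_eq_mul])
  have hΛ := choiMap_mem_channels hJ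
  refine ⟨choiMap J, hΛ, Real.iSup_le (fun ρ => ?_) hε⟩
  refine traceNorm_tensorId_le_of_tests (fun p hp => sub_nonpos.1 (hJ' ⟨p, hp⟩)) ρ.2 ?_
  exact (tensorId_mem_states (comp_mem_channels hΦ₁ hΛ) ρ.2).1.isHermitian.sub
    (tensorId_mem_states hΦ₂ ρ.2).1.isHermitian

theorem channelRange_subset_states {Φ : Matrix a a ℂ →ₗ[ℂ] Matrix b b ℂ} (hΦ : Φ ∈ channels a b) :
    channelRange (tensorId r Φ) ⊆ states (b × r) := by
  rintro _ ⟨ρ, hρ, rfl⟩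
  exact tensorId_mem_states hΦ hρ

/-- The one-way conversion distance is a one-sided Hausdorff distance of the ranges. -/
theorem deltaPre_eq_iSup_iInf [Nonempty a] [Nonempty b] (hc : Fintype.card b ≤ Fintype.card r)
    {Φ₁ : Matrix a a ℂ →ₗ[ℂ] Matrix c c ℂ} (hΦ₁ : Φ₁ ∈ channels a c)
    {Φ₂ : Matrix b b ℂ →ₗ[ℂ] Matrix c c ℂ} (hΦ₂ : Φ₂ ∈ channels b c) :
    deltaPre Φ₁ Φ₂ = ⨆ t : channelRange (tensorId r Φ₂), ⨅ s : channelRange (tensorId r Φ₁),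
      stateDist (s : Matrix (c × r) (c × r) ℂ) t := by
  have : Nonempty r := Fintype.card_pos_iff.1 (Fintype.card_pos.trans_le hc)
  have hne₁ : Nonempty (channelRange (tensorId r Φ₁)) := (states_nonempty.image _).to_subtype
  have hne₂ : Nonempty (channelRange (tensorId r Φ₂)) := (states_nonempty.image _).to_subtype
  have hneΛ : Nonempty (channels b a) := channels_nonempty.to_subtype
  have hbelow : ∀ t : Matrix (c × r) (c × r) ℂ, BddBelow (Set.range
      fun s : channelRange (tensorId r Φ₁) => stateDist (s : Matrix (c × r) (c × r) ℂ) t) :=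
    fun t => ⟨0, by rintro _ ⟨s, rfl⟩; exact stateDist_nonneg _ _⟩
  apply le_antisymm
  · refine le_of_forall_gt fun ε hε => ?_
    have habove : BddAbove (Set.range fun t : channelRange (tensorId r Φ₂) =>
        ⨅ s : channelRange (tensorId r Φ₁), stateDist (s : Matrix (c × r) (c × r) ℂ) t) := by
      refine ⟨4, ?_⟩
      rintro _ ⟨t, rfl⟩
      obtain ⟨s⟩ := hne₁
      exact (ciInf_le (hbelow t) s).trans (stateDist_le_four
        (channelRange_subset_states hΦ₁ s.2) (channelRange_subset_states hΦ₂ t.2))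
    obtain ⟨ε', hε', hεε'⟩ := exists_between hε
    have hpos : 0 ≤ ε' := (Real.iSup_nonneg fun t => Real.iInf_nonneg fun s =>
      stateDist_nonneg _ _).trans hε'.le
    obtain ⟨Λ, hΛ, hle⟩ := exists_channel_diamondNorm_le hc hΦ₁ hΦ₂ hpos fun ρ hρ => by
      have h1 := (le_ciSup habove ⟨_, ρ, hρ, rfl⟩).trans_lt hε'
      obtain ⟨⟨_, ω, hω, rfl⟩, hlt⟩ := exists_lt_of_ciInf_lt h1
      exact ⟨ω, hω, hlt⟩
    refine lt_of_le_of_lt (ciInf_le ⟨0, ?_⟩ (⟨Λ, hΛ⟩ : channels b a)) (hle.trans_lt hεε')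
    rintro _ ⟨Λ, rfl⟩
    exact diamondNorm_nonneg _
  · refine ciSup_le ?_
    rintro ⟨_, ρ, hρ, rfl⟩
    refine le_ciInf fun Λ => ?_
    have hω := tensorId_mem_states Λ.2 hρ
    refine (ciInf_le (hbelow _) ⟨_, _, hω, rfl⟩).trans ?_
    dsimp only
    rw [stateDist, restrictRight_tensorId hΦ₁.2, restrictRight_tensorId Λ.2.2,
      restrictRight_tensorId hΦ₂.2, purifiedDist_self (restrictRight_mem_states hρ), mul_zero,
      add_zero, ← tensorId_comp, ← tensorId_sub]
    exact traceNorm_tensorId_sub_le_diamondNorm (comp_mem_channels hΦ₁ Λ.2) hΦ₂ hρ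

end Distance

end PreDist

theorem mainTheorem7 {A₀ A₀' A₁ R : Type*}
    [Fintype A₀] [DecidableEq A₀] [Nonempty A₀]
    [Fintype A₀'] [DecidableEq A₀'] [Nonempty A₀']
    [Fintype A₁] [DecidableEq A₁] [Fintype R] [DecidableEq R]
    (hR : Fintype.card R = max (Fintype.card A₀) (Fintype.card A₀'))
    (Φ₁ : Matrix A₀ A₀ ℂ →ₗ[ℂ] Matrix A₁ A₁ ℂ) (hΦ₁ : Φ₁ ∈ PreDist.channels A₀ A₁)
    (Φ₂ : Matrix A₀' A₀' ℂ →ₗ[ℂ] Matrix A₁ A₁ ℂ) (hΦ₂ : Φ₂ ∈ PreDist.channels A₀' A₁) :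
    PreDist.DeltaPre Φ₁ Φ₂ =
      PreDist.hausdorffDist PreDist.stateDist
        (PreDist.channelRange (PreDist.tensorId R Φ₁))
        (PreDist.channelRange (PreDist.tensorId R Φ₂)) := by
  rw [PreDist.DeltaPre, PreDist.hausdorffDist, max_comm,
    PreDist.deltaPre_eq_iSup_iInf (r := R) (hR ▸ le_max_right _ _) hΦ₁ hΦ₂,
    PreDist.deltaPre_eq_iSup_iInf (r := R) (hR ▸ le_max_left _ _) hΦ₂ hΦ₁]
  congr 2
  funext s
  exact congrArg iInf (funext fun t => PreDist.stateDist_comm _ _)
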